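/- Let $\mathcal B$ be a generalized Boolean algebra (a distributive lattice with least element $\emptyset$ and relative complements), $\mathcal L$ a set, $(\theta_\alpha)_{\alpha\in\mathcal L}$ a family of generalized Boolean algebra morphisms $\theta_\alpha:\mathcal B\to\mathcal B$ (maps preserving $\emptyset,\cup,\cap,\setminus$), and $(\mathcal I_\alpha)_{\alpha\in\mathcal L}$ a family of ideals of $\mathcal B$ such that $A\in\mathcal I_\alpha$ whenever $A\subseteq\theta_\alpha(C)$ for some $C\in\mathcal B$. Such a quadruple $(\mathcal B,\mathcal L,\theta,\mathcal I)$ is called a generalized Boolean dynamical system. For $A\in\mathcal B$ put $\Delta_A=\{\alpha\in\mathcal L:\theta_\alpha(A)\neq\emptyset\}$, and call $A$ regular if $0<|\Delta_C|<\infty$ for every nonempty $C\in\mathcal B$ with $C\subseteq A$. Let $R$ be a unital commutative ring. All $R$-algebras below are associative but not necessarily unital, and homomorphisms are $R$-linear and multiplicative. Let $L_R(\mathcal B,\mathcal L,\theta,\mathcal I)$ be the $R$-algebra generated by symbols $p_A$ ($A\in\mathcal B$) and $s_{\alpha,C},s_{\alpha,C}^*$ ($\alpha\in\mathcal L$, $C\in\mathcal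 I_\alpha$) subject to the relations 1. $p_\emptyset=0$, $p_{A\cap A'}=p_Ap_{A'}$, $p_{A\cup A'}=p_A+p_{A'}-p_{A\cap A'}$; 2. $p_As_{\alpha,C}=s_{\alpha,C}\,p_{\theta_\alpha(A)}$ and $s_{\alpha,C}^*p_A=p_{\theta_\alpha(A)}s_{\alpha,C}^*$; 3. $s_{\alpha,C}^*s_{\alpha',C'}=\delta_{\alpha,\alpha'}\,p_{C\cap C'}$; 4. $s_{\alpha,C}\,p_A=s_{\alpha,C\cap A}$ and $p_As_{\alpha,C}^*=s_{\alpha,C\cap A}^*$; 5. $p_A=\sum_{\alpha\in\Delta_A}s_{\alpha,\theta_\alpha(A)}s_{\alpha,\theta_\alpha(A)}^*$ for every regular $A\in\mathcal B$. It is $\mathbb Z$-graded with $p_A$, $s_{\alpha,C}$, $s_{\alpha,C}^*$ of degrees $0$, $1$, $-1$; the component of degree $n$ is the $R$-span of the products of generators of total degree $n$. **Theorem (graded uniqueness).** Let $T=\bigoplus_{n\in\mathbb Z}T_n$ be a $\mathbb Z$-graded $R$-algebra (the $T_n$ are $R$-submodules with $T_mT_n\subseteq T_{m+n}$), and let $f:L_R(\mathcal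 B,\mathcal L,\theta,\mathcal I)\to T$ be a $\mathbb Z$-graded homomorphism of $R$-algebras, that is, an $R$-algebra homomorphism mapping the component of degree $n$ into $T_n$ for every $n\in\mathbb Z$. Then $f$ is injective if and only if $f(rp_A)\neq0$ for all $\emptyset\neq A\in\mathcal B$ and all $0\neq r\in R$. -/

import Mathlib

/-- A generalized Boolean dynamical system `(𝓑, ℒ, θ, 𝓘)`: a generalized Boolean algebra `𝓑`,
an alphabet `ℒ`, a generalized Boolean algebra endomorphism `θ α` of `𝓑` for every letter `α`, and
an ideal `𝓘 α` of `𝓑` for every letter `α`, containing every `A` that lies below some `θ α B`. -/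
structure GenBoolDynSystem (B : Type*) [GeneralizedBooleanAlgebra B] (L : Type*) where
  θ : L → B → B
  map_bot : ∀ α, θ α ⊥ = ⊥
  map_sup : ∀ α A A', θ α (A ⊔ A') = θ α A ⊔ θ α A'
  map_inf : ∀ α A A', θ α (A ⊓ A') = θ α A ⊓ θ α A'
  map_sdiff : ∀ α A A', θ α (A \ A') = θ α A \ θ α A'
  ideal : L → Order.Ideal B
  mem_ideal_of_le : ∀ α A C, A ≤ θ α C → A ∈ ideal α

namespace GenBoolDynSystem

noncomputable section

variable {B L : Type*} [GeneralizedBooleanAlgebra B] (S : GenBoolDynSystem B L)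

/-- `Δ_A`, the set of letters `α` with `θ α A ≠ ∅`. -/
def Δ (A : B) : Set L := {α | S.θ α A ≠ ⊥}

/-- `A` is regular: every nonempty `C ⊆ A` satisfies `0 < |Δ_C| < ∞`. -/
def IsRegular (A : B) : Prop :=
  ∀ C, C ≤ A → C ≠ ⊥ → (S.Δ C).Nonempty ∧ (S.Δ C).Finite

theorem IsRegular.finite {S : GenBoolDynSystem B L} {A : B} (h : S.IsRegular A) :
    (S.Δ A).Finite := by
  by_cases hA : A = ⊥
  · subst hA
    have : S.Δ ⊥ = ∅ := by
      ext α
      simp [Δ, S.map_bot]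
    rw [this]
    exact Set.finite_empty
  · exact (h A le_rfl hA).2

/-- `θ α A`, as a member of the ideal `𝓘 α`. -/
def θI (α : L) (A : B) : S.ideal α := ⟨S.θ α A, S.mem_ideal_of_le α _ A le_rfl⟩

/-- `C ∩ A` for `C ∈ 𝓘 α` and `A ∈ 𝓑`, as a member of the ideal `𝓘 α`. -/
def infI {α : L} (C : S.ideal α) (A : B) : S.ideal α :=
  ⟨(C : B) ⊓ A, (S.ideal α).lower inf_le_left C.2⟩

/-- The generating symbols `p_A` for `A ∈ 𝓑`, and `s_{α,C}`, `s_{α,C}^*` for `C ∈ 𝓘 α`. -/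
inductive Gen
  | p (A : B) : Gen
  | s (α : L) (C : S.ideal α) : Gen
  | sStar (α : L) (C : S.ideal α) : Gen

/-- The degree of a generating symbol. -/
def Gen.deg {S : GenBoolDynSystem B L} : S.Gen → ℤ
  | .p _ => 0
  | .s _ _ => 1
  | .sStar _ _ => -1

/-- The degree of a nonempty word in the generating symbols: the sum of the degrees. -/
def wordDeg (w : FreeSemigroup S.Gen) : ℤ :=
  (FreeSemigroup.lift (fun g : S.Gen => Multiplicative.ofAdd g.deg) w).toAdd

variable (R : Type*) [CommRing R]

/-- The free (associative, not necessarily unital) `R`-algebra on the generating symbols. -/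
abbrev FreeAlg := MonoidAlgebra R (FreeSemigroup S.Gen)

/-- A generating symbol, as an element of the free algebra. -/
def gen (g : S.Gen) : S.FreeAlg R := MonoidAlgebra.single (FreeSemigroup.of g) 1

/-- The defining relations of the algebra of a generalized Boolean dynamical system. -/
inductive Rel : S.FreeAlg R → S.FreeAlg R → Prop
  | p_bot : Rel (S.gen R (.p ⊥)) 0
  | p_inf (A A' : B) : Rel (S.gen R (.p (A ⊓ A'))) (S.gen R (.p A) * S.gen R (.p A'))
  | p_sup (A A' : B) : Rel (S.gen R (.p (A ⊔ A')))
      (S.gen R (.p A) + S.gen R (.p A') - S.gen R (.p (A ⊓ A')))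
  | p_mul_s (A : B) (α : L) (C : S.ideal α) :
      Rel (S.gen R (.p A) * S.gen R (.s α C)) (S.gen R (.s α C) * S.gen R (.p (S.θ α A)))
  | sStar_mul_p (A : B) (α : L) (C : S.ideal α) :
      Rel (S.gen R (.sStar α C) * S.gen R (.p A))
        (S.gen R (.p (S.θ α A)) * S.gen R (.sStar α C))
  | sStar_mul_s (α : L) (C C' : S.ideal α) :
      Rel (S.gen R (.sStar α C) * S.gen R (.s α C')) (S.gen R (.p ((C : B) ⊓ (C' : B))))
  | sStar_mul_s_of_ne (α α' : L) (C : S.ideal α) (C' : S.ideal α') (h : α ≠ α') :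
      Rel (S.gen R (.sStar α C) * S.gen R (.s α' C')) 0
  | s_mul_p (α : L) (C : S.ideal α) (A : B) :
      Rel (S.gen R (.s α C) * S.gen R (.p A)) (S.gen R (.s α (S.infI C A)))
  | p_mul_sStar (α : L) (C : S.ideal α) (A : B) :
      Rel (S.gen R (.p A) * S.gen R (.sStar α C)) (S.gen R (.sStar α (S.infI C A)))
  | p_regular (A : B) (hA : S.IsRegular A) :
      Rel (S.gen R (.p A)) (∑ α ∈ hA.finite.toFinset,
        S.gen R (.s α (S.θI α A)) * S.gen R (.sStar α (S.θI α A)))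

/-- The smallest congruence of the free algebra (for addition, multiplication and scalar
multiplication) that contains the defining relations. Closing the relations under scalar
multiplication before generating a ring congruence makes it compatible with scalars, see
`con_smul`; this is not automatic because the free algebra has no unit. -/
def con : RingCon (S.FreeAlg R) :=
  ringConGen fun x y => ∃ (r : R) (a b : S.FreeAlg R), S.Rel R a b ∧ x = r • a ∧ y = r • b

theorem con_smul (r : R) {x y : S.FreeAlg R} (h : S.con R x y) :
    S.con R (r • x) (r • y) := by
  change RingConGen.Rel _ x y at h
  induction h with
  | of x y h =>
    obtain ⟨t, a, b, hab, rfl, rfl⟩ := h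
    exact RingConGen.Rel.of _ _ ⟨r * t, a, b, hab, by rw [mul_smul], by rw [mul_smul]⟩
  | refl x => exact (S.con R).refl _
  | symm _ ih => exact (S.con R).symm ih
  | trans _ _ ih₁ ih₂ => exact (S.con R).trans ih₁ ih₂
  | add _ _ ih₁ ih₂ =>
    rw [smul_add, smul_add]
    exact (S.con R).add ih₁ ih₂
  | mul _ h₂ ih₁ _ =>
    rw [← smul_mul_assoc, ← smul_mul_assoc]
    exact (S.con R).mul ih₁ h₂

/-- The `R`-algebra `L_R(𝓑, ℒ, θ, 𝓘)`: the (associative, not necessarily unital) `R`-algebra given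
by the generating symbols and the defining relations. -/
def Alg : Type _ := (S.con R).Quotient

instance : NonUnitalRing (S.Alg R) := inferInstanceAs (NonUnitalRing (S.con R).Quotient)

/-- The quotient map from the free algebra. -/
def toAlg (x : S.FreeAlg R) : S.Alg R := RingCon.toQuotient (c := S.con R) x

theorem toAlg_surjective : Function.Surjective (S.toAlg R) := Quotient.mk''_surjective

instance : SMul R (S.Alg R) where
  smul r := Quotient.map (r • ·) fun _ _ h => S.con_smul R r h

instance : Module R (S.Alg R) :=
  Function.Surjective.module R
    (⟨⟨S.toAlg R, rfl⟩, fun _ _ => rfl⟩ : S.FreeAlg R →+ S.Alg R) (S.toAlg_surjective R)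
    fun _ _ => rfl

instance : IsScalarTower R (S.Alg R) (S.Alg R) where
  smul_assoc r x y := by
    obtain ⟨a, rfl⟩ := S.toAlg_surjective R x
    obtain ⟨b, rfl⟩ := S.toAlg_surjective R y
    exact congrArg (S.toAlg R) (smul_mul_assoc r a b)

instance : SMulCommClass R (S.Alg R) (S.Alg R) where
  smul_comm r x y := by
    obtain ⟨a, rfl⟩ := S.toAlg_surjective R x
    obtain ⟨b, rfl⟩ := S.toAlg_surjective R y
    exact congrArg (S.toAlg R) (mul_smul_comm r a b).symm

/-- The element `p_A` of `L_R(𝓑, ℒ, θ, 𝓘)`. -/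
def p (A : B) : S.Alg R := S.toAlg R (S.gen R (.p A))

/-- The homogeneous component of degree `n` of `L_R(𝓑, ℒ, θ, 𝓘)`, in the `ℤ`-grading in which
`p_A`, `s_{α,C}`, `s_{α,C}^*` have degrees `0`, `1`, `-1`: the `R`-span of the products of
generators of total degree `n`. -/
def component (n : ℤ) : Submodule R (S.Alg R) :=
  Submodule.span R
    {x | ∃ w : FreeSemigroup S.Gen, S.wordDeg w = n ∧ x = S.toAlg R (MonoidAlgebra.single w 1)}

end

end GenBoolDynSystem

/-! For the forward implication one needs `r • p_A ≠ 0` in the algebra itself. The algebra acts on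
functions of boundary paths, where `p_A` restricts a function to the paths starting in `A`, and such
paths exist for every nonempty `A` (`smul_p_ne_zero`).

For the converse, the components of `T` are independent and those of the algebra span it, so it
suffices that no nonzero homogeneous `x` is killed by `f`. If `x` has positive degree, then `x = ∑ s
s^* x` for finitely many suitable `s`, so `x` vanishes once every `s^* x` does, and these have
degree one less. Negative degrees are symmetric. This leaves degree `0`, which is the union of the
submodules `level n`.

On `level 0`, the span of the `p_A`, elements are piecewise constant and the hypothesis on `f`
applies directly. On `level (n + 1)` write `x = q + z` with `q` a combination of the `p_A` and `z` a
sum of terms `s y s^*`. Wherever `q` has a constant value `r ≠ 0`, the equation `f x = 0` forces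
regularity (`isRegular_of_map_eq_zero`), so relation 5 rewrites `q` in the form of `z`. Then all
`s^* x s'` lie in `level n`, vanish by induction, and determine `x` (`eq_zero_of_mem_level`). -/

namespace GenBoolDynSystem

/-! ### Prime sets, boundary paths and the nonvanishing of `r • p_A`. -/

section Representation

variable {B L : Type*} [GeneralizedBooleanAlgebra B]

/-- A set of elements of a lattice is prime if its indicator function is a lattice morphism
preserving `⊥`. The empty set is allowed. -/
structure IsPrimeSet (u : Set B) : Prop where
  bot_notMem : ⊥ ∉ u
  inf_mem_iff : ∀ A A', A ⊓ A' ∈ u ↔ A ∈ u ∧ A' ∈ u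
  sup_mem_iff : ∀ A A', A ⊔ A' ∈ u ↔ A ∈ u ∨ A' ∈ u

theorem IsPrimeSet.sdiff_mem {u : Set B} (hu : IsPrimeSet u) {A A' : B}
    (hA : A ∈ u) (hA' : A' ∉ u) : A \ A' ∈ u := by
  have h : A ⊓ A' ⊔ A \ A' ∈ u := by rwa [sup_inf_sdiff]
  rcases (hu.sup_mem_iff _ _).1 h with h | h
  · exact absurd ((hu.inf_mem_iff _ _).1 h).2 hA'
  · exact h

/-- Every downward directed nonempty set avoiding `⊥` is contained in a prime set. -/
theorem exists_isPrimeSet_superset {F : Set B} (hne : F.Nonempty)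
    (hinf : ∀ A ∈ F, ∀ A' ∈ F, A ⊓ A' ∈ F) (hbot : ⊥ ∉ F) :
    ∃ u, IsPrimeSet u ∧ F ⊆ u := by
  let G : Set B := {A | ∃ A' ∈ F, A' ≤ A}
  have hG : Order.IsPFilter G := by
    refine Order.IsPFilter.of_def (hne.mono fun A hA => ⟨A, hA, le_rfl⟩) ?_ ?_
    · rintro A ⟨A₁, hA₁, h₁⟩ A' ⟨A₂, hA₂, h₂⟩
      exact ⟨A ⊓ A', ⟨A₁ ⊓ A₂, hinf _ hA₁ _ hA₂, inf_le_inf h₁ h₂⟩, inf_le_left, inf_le_right⟩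
    · rintro A A' hle ⟨A₁, hA₁, h₁⟩
      exact ⟨A₁, hA₁, h₁.trans hle⟩
  have hdisj : Disjoint (hG.toPFilter : Set B) (Order.Ideal.principal (⊥ : B)) := by
    refine Set.disjoint_left.2 ?_
    rintro A ⟨A₁, hA₁, h₁⟩ hA
    have : A = ⊥ := le_bot_iff.1 (Order.Ideal.mem_principal.1 hA)
    subst this
    exact hbot (le_bot_iff.1 h₁ ▸ hA₁)
  -- The prime set is the complement of a prime ideal disjoint from the filter generated by `F`.
  obtain ⟨J, hJ, -, hJF⟩ := DistribLattice.prime_ideal_of_disjoint_filter_ideal hdisj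
  refine ⟨(J : Set B)ᶜ, ⟨?_, ?_, ?_⟩, ?_⟩
  · simp
  · intro A A'
    have : A ⊓ A' ∈ J ↔ A ∈ J ∨ A' ∈ J :=
      ⟨fun h => hJ.mem_or_mem h, fun h => h.elim (J.lower inf_le_left) (J.lower inf_le_right)⟩
    simp [this]
  · intro A A'
    simp [Order.Ideal.sup_mem_iff]
    tauto
  · intro A hA hAJ
    exact Set.disjoint_left.1 hJF (⟨A, hA, le_rfl⟩ : A ∈ hG.toPFilter) hAJ

theorem exists_isPrimeSet_mem {A : B} (hA : A ≠ ⊥) : ∃ u, IsPrimeSet u ∧ A ∈ u := by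
  obtain ⟨u, hu, hAu⟩ := exists_isPrimeSet_superset (F := {A}) ⟨A, rfl⟩
    (by simp) (by simpa using hA.symm)
  exact ⟨u, hu, hAu rfl⟩

variable (S : GenBoolDynSystem B L)

theorem θ_mono (α : L) {A A' : B} (h : A ≤ A') : S.θ α A ≤ S.θ α A' := by
  rw [← inf_eq_left.2 h, S.map_inf]
  exact inf_le_right

/-- The preimage is empty when no `θ α A` lies in `u`; prime sets are allowed to be empty for this
reason. -/
theorem isPrimeSet_preimage (α : L) {u : Set B} (hu : IsPrimeSet u) :
    IsPrimeSet (S.θ α ⁻¹' u) where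
  bot_notMem := by simpa [S.map_bot] using hu.bot_notMem
  inf_mem_iff A A' := by simpa [S.map_inf] using hu.inf_mem_iff _ _
  sup_mem_iff A A' := by simpa [S.map_sup] using hu.sup_mem_iff _ _

/-- A prime set containing a regular element is the preimage, under some `θ α`, of a
prime set. -/
theorem exists_eq_preimage {u : Set B} (hu : IsPrimeSet u) {A : B} (hA : S.IsRegular A)
    (hAu : A ∈ u) : ∃ α v, IsPrimeSet v ∧ u = S.θ α ⁻¹' v := by
  -- Otherwise each letter `α` kills some `C α ∈ u`. Intersecting `A` with the `C α` for the
  -- finitely many `α ∈ Δ_A` gives a nonempty `D ≤ A` with `Δ_D` empty, against regularity.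
  obtain ⟨α, hα⟩ : ∃ α, ∀ C ∈ u, S.θ α C ≠ ⊥ := by
    by_contra! h
    choose C hCu hC using h
    have key : ∀ F : Finset L, ∃ D ∈ u, D ≤ A ∧ ∀ α ∈ F, S.θ α D = ⊥ := by
      classical
      intro F
      induction F using Finset.induction_on with
      | empty => exact ⟨A, hAu, le_rfl, by simp⟩
      | insert α F _ ih =>
        obtain ⟨D, hD, hDA, h⟩ := ih
        refine ⟨D ⊓ C α, (hu.inf_mem_iff _ _).2 ⟨hD, hCu α⟩, inf_le_left.trans hDA, ?_⟩
        intro β hβ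
        rw [S.map_inf]
        rcases Finset.mem_insert.1 hβ with rfl | hβ
        · simp [hC]
        · simp [h β hβ]
    obtain ⟨D, hD, hDA, h⟩ := key hA.finite.toFinset
    have hD0 : D ≠ ⊥ := fun h0 => hu.bot_notMem (h0 ▸ hD)
    obtain ⟨β, hβ⟩ := (hA D hDA hD0).1
    refine hβ (h β ?_)
    rw [Set.Finite.mem_toFinset]
    exact fun h0 => hβ (le_bot_iff.1 (h0 ▸ S.θ_mono β hDA))
  obtain ⟨v, hv, huv⟩ := exists_isPrimeSet_superset (F := S.θ α '' u) ⟨_, A, hAu, rfl⟩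
    (by
      rintro _ ⟨C, hC, rfl⟩ _ ⟨D, hD, rfl⟩
      exact ⟨C ⊓ D, (hu.inf_mem_iff _ _).2 ⟨hC, hD⟩, S.map_inf _ _ _⟩)
    (by
      rintro ⟨C, hC, h⟩
      exact hα C hC h)
  -- Equality holds by maximality: if `C ∉ u` then `A \ C ∈ u`, so `v` cannot contain `θ α C`, which
  -- is disjoint from `θ α (A \ C)`.
  refine ⟨α, v, hv, Set.Subset.antisymm (fun C hC => huv ⟨C, hC, rfl⟩) fun C hC => ?_⟩
  by_contra hCu
  have h1 : S.θ α (A \ C) ∈ v := huv ⟨_, hu.sdiff_mem hAu hCu, rfl⟩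
  have h2 := (hv.inf_mem_iff _ _).2 ⟨hC, h1⟩
  rw [S.map_sdiff, inf_sdiff_self_right] at h2
  exact hv.bot_notMem h2

/-- The condition linking an entry of a boundary path to the set that follows it. -/
def Link (y : Option L × Set B) (v : Set B) : Prop :=
  match y.1 with
  | some α => (∃ C ∈ S.ideal α, C ∈ v) ∧ y.2 = S.θ α ⁻¹' v
  | none => ∀ A ∈ y.2, ¬ S.IsRegular A

/-- Boundary paths: sequences of prime sets linked by letters. A missing letter marks the end of
the path; whatever comes after it plays no role. -/
def BPath : Type _ :=
  {x : ℕ → Option L × Set B // ∀ n, IsPrimeSet (x n).2 ∧ S.Link (x n) (x (n + 1)).2}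

namespace BPath

variable {S}

/-- The set at which a boundary path starts. -/
def start (x : S.BPath) : Set B := (x.1 0).2

/-- The first letter of a boundary path, if there is one. -/
def letter (x : S.BPath) : Option L := (x.1 0).1

/-- A boundary path without its first entry. -/
def tail (x : S.BPath) : S.BPath := ⟨fun n => x.1 (n + 1), fun n => x.2 (n + 1)⟩

/-- The boundary path obtained by putting a letter in front of a boundary path. -/
def cons (α : L) (x : S.BPath) (h : ∃ C ∈ S.ideal α, C ∈ x.start) : S.BPath :=
  ⟨fun n => n.casesOn (some α, S.θ α ⁻¹' x.start) x.1, fun n => by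
    cases n with
    | zero => exact ⟨S.isPrimeSet_preimage α (x.2 0).1, h, rfl⟩
    | succ n => exact x.2 n⟩

theorem isPrimeSet_start (x : S.BPath) : IsPrimeSet x.start := (x.2 0).1

@[simp] theorem start_cons (α : L) (x : S.BPath) (h) : (cons α x h).start = S.θ α ⁻¹' x.start := rfl

@[simp] theorem letter_cons (α : L) (x : S.BPath) (h) : (cons α x h).letter = some α := rfl

@[simp] theorem tail_cons (α : L) (x : S.BPath) (h) : (cons α x h).tail = x := rfl

theorem start_eq {x : S.BPath} {α : L} (h : x.letter = some α) :
    x.start = S.θ α ⁻¹' x.tail.start := by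
  have := (x.2 0).2
  rw [Link, show (x.1 0).1 = some α from h] at this
  exact this.2

theorem cons_tail {x : S.BPath} {α : L} (h : x.letter = some α) (h') :
    cons α x.tail h' = x := by
  refine Subtype.ext (funext fun n => ?_)
  cases n with
  | zero => exact Prod.ext h.symm (start_eq h).symm
  | succ n => rfl

theorem exists_letter {x : S.BPath} {A : B} (hA : S.IsRegular A) (hx : A ∈ x.start) :
    ∃ α, x.letter = some α := by
  cases h : x.letter with
  | some α => exact ⟨α, rfl⟩
  | none =>
    have := (x.2 0).2
    rw [Link, show (x.1 0).1 = none from h] at this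
    exact absurd hA (this A hx)

/-- The path is built by recursion: `exists_eq_preimage` supplies a letter and the next prime set as
long as the current one contains a regular element. Otherwise the path ends, and the set is repeated
as filler. -/
theorem exists_mem_start (S : GenBoolDynSystem B L) {A : B} (hA : A ≠ ⊥) :
    ∃ x : S.BPath, A ∈ x.start := by
  obtain ⟨u₀, hu₀, hAu₀⟩ := exists_isPrimeSet_mem hA
  have step : ∀ u : {u : Set B // IsPrimeSet u}, ∃ (a : Option L) (v : {u : Set B // IsPrimeSet u}),
      S.Link (a, u.1) v.1 := by
    rintro ⟨u, hu⟩
    by_cases h : ∃ A ∈ u, S.IsRegular A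
    · obtain ⟨A, hAu, hA⟩ := h
      obtain ⟨α, v, hv, huv⟩ := S.exists_eq_preimage hu hA hAu
      refine ⟨some α, ⟨v, hv⟩, ⟨S.θ α A, S.mem_ideal_of_le α _ A le_rfl, ?_⟩, huv⟩
      rw [huv] at hAu
      exact hAu
    · exact ⟨none, ⟨u, hu⟩, fun A hA hr => h ⟨A, hA, hr⟩⟩
  choose a v hv using step
  let w : ℕ → {u : Set B // IsPrimeSet u} := fun n => Nat.rec ⟨u₀, hu₀⟩ (fun _ u => v u) n
  exact ⟨⟨fun n => (a (w n), (w n).1), fun n => ⟨(w n).2, hv (w n)⟩⟩, hAu₀⟩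

end BPath

open Classical in
/-- The operator on functions of boundary paths by which a generating symbol acts. -/
noncomputable def genOp (R : Type*) [CommRing R] : S.Gen → Module.End R (S.BPath → R)
  | .p A =>
    { toFun := fun φ x => if A ∈ x.start then φ x else 0
      map_add' := fun φ ψ => by ext x; by_cases h : A ∈ x.start <;> simp [h]
      map_smul' := fun r φ => by ext x; by_cases h : A ∈ x.start <;> simp [h] }
  | .s α C =>
    { toFun := fun φ x => if x.letter = some α ∧ (C : B) ∈ x.tail.start then φ x.tail else 0
      map_add' := fun φ ψ => by
        ext x; by_cases h : x.letter = some α ∧ (C : B) ∈ x.tail.start <;> simp [h]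
      map_smul' := fun r φ => by
        ext x; by_cases h : x.letter = some α ∧ (C : B) ∈ x.tail.start <;> simp [h] }
  | .sStar α C =>
    { toFun := fun φ x => if h : (C : B) ∈ x.start then φ (x.cons α ⟨C, C.2, h⟩) else 0
      map_add' := fun φ ψ => by ext x; by_cases h : (C : B) ∈ x.start <;> simp [h]
      map_smul' := fun r φ => by ext x; by_cases h : (C : B) ∈ x.start <;> simp [h] }

section

variable (R : Type*) [CommRing R]

open Classical in
theorem genOp_p_apply (A : B) (φ : S.BPath → R) (x : S.BPath) :
    S.genOp R (.p A) φ x = if A ∈ x.start then φ x else 0 := rfl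

open Classical in
theorem genOp_s_apply (α : L) (C : S.ideal α) (φ : S.BPath → R) (x : S.BPath) :
    S.genOp R (.s α C) φ x =
      if x.letter = some α ∧ (C : B) ∈ x.tail.start then φ x.tail else 0 := rfl

open Classical in
theorem genOp_sStar_apply (α : L) (C : S.ideal α) (φ : S.BPath → R) (x : S.BPath) :
    S.genOp R (.sStar α C) φ x =
      if h : (C : B) ∈ x.start then φ (x.cons α ⟨C, C.2, h⟩) else 0 := rfl

/-- The representation of the free algebra on functions of boundary paths. -/
noncomputable def boundaryRep : S.FreeAlg R →ₙₐ[R] Module.End R (S.BPath → R) :=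
  MonoidAlgebra.liftMagma R (FreeSemigroup.lift (S.genOp R))

@[simp] theorem boundaryRep_gen (g : S.Gen) : S.boundaryRep R (S.gen R g) = S.genOp R g := by
  simp [boundaryRep, gen, MonoidAlgebra.liftMagma]

/-- Relation 5 is what the boundary condition is for. The summand of `α` restricts functions to
paths starting in `A` with first letter `α`, and a path starting in a regular `A` has exactly one
first letter. -/
theorem boundaryRep_eq_of_rel {a b : S.FreeAlg R} (h : S.Rel R a b) :
    S.boundaryRep R a = S.boundaryRep R b := by
  classical
  cases h with
  | p_bot =>
    ext φ x
    simp [genOp_p_apply, x.isPrimeSet_start.bot_notMem]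
  | p_inf A A' =>
    ext φ x
    by_cases h : A ∈ x.start <;> simp [genOp_p_apply, x.isPrimeSet_start.inf_mem_iff, h]
  | p_sup A A' =>
    ext φ x
    by_cases h : A ∈ x.start <;> by_cases h' : A' ∈ x.start <;>
      simp [genOp_p_apply, x.isPrimeSet_start.inf_mem_iff, x.isPrimeSet_start.sup_mem_iff, h, h']
  | p_mul_s A α C =>
    ext φ x
    by_cases h : x.letter = some α
    · simp [genOp_p_apply, genOp_s_apply, h, BPath.start_eq h, ← ite_and, and_comm]
    · simp [genOp_p_apply, genOp_s_apply, h]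
  | sStar_mul_p A α C =>
    ext φ x
    by_cases h : (C : B) ∈ x.start <;> simp [genOp_p_apply, genOp_sStar_apply, h]
  | sStar_mul_s α C C' =>
    ext φ x
    by_cases h : (C : B) ∈ x.start <;>
      simp [genOp_p_apply, genOp_s_apply, genOp_sStar_apply, x.isPrimeSet_start.inf_mem_iff, h]
  | sStar_mul_s_of_ne α α' C C' hne =>
    ext φ x
    simp [genOp_s_apply, genOp_sStar_apply, hne]
  | s_mul_p α C A =>
    ext φ x
    by_cases h : x.letter = some α <;> by_cases h' : (C : B) ∈ x.tail.start <;>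
      simp [genOp_p_apply, genOp_s_apply, infI, x.tail.isPrimeSet_start.inf_mem_iff, h, h']
  | p_mul_sStar α C A =>
    ext φ x
    by_cases h : (C : B) ∈ x.start <;> by_cases h' : A ∈ x.start <;>
      simp [genOp_p_apply, genOp_sStar_apply, infI, x.isPrimeSet_start.inf_mem_iff, h, h']
  | p_regular A hA =>
    ext φ x
    have hterm : ∀ α, (S.genOp R (.s α (S.θI α A)) * S.genOp R (.sStar α (S.θI α A))) φ x =
        if x.letter = some α ∧ A ∈ x.start then φ x else 0 := by
      intro α
      by_cases h : x.letter = some α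
      · by_cases h' : A ∈ x.start
        · have h'' : S.θ α A ∈ x.tail.start := by rwa [BPath.start_eq h] at h'
          simp [genOp_s_apply, genOp_sStar_apply, θI, h, h', h'', BPath.cons_tail h]
        · have h'' : S.θ α A ∉ x.tail.start := by rwa [BPath.start_eq h] at h'
          simp [genOp_s_apply, θI, h, h', h'']
      · simp [genOp_s_apply, h]
    simp only [map_sum, map_mul, boundaryRep_gen, LinearMap.sum_apply, Finset.sum_apply, hterm,
      genOp_p_apply]
    by_cases h : A ∈ x.start
    · obtain ⟨α, hα⟩ := x.exists_letter hA h
      have hmem : α ∈ S.Δ A := by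
        intro h0
        rw [BPath.start_eq hα, Set.mem_preimage, h0] at h
        exact x.tail.isPrimeSet_start.bot_notMem h
      simp [h, hα, hmem]
    · simp [h]

theorem boundaryRep_eq_of_con {x y : S.FreeAlg R} (h : S.con R x y) :
    S.boundaryRep R x = S.boundaryRep R y := by
  change RingConGen.Rel _ x y at h
  induction h with
  | of x y h =>
    obtain ⟨r, a, b, hab, rfl, rfl⟩ := h
    rw [map_smul, map_smul, S.boundaryRep_eq_of_rel R hab]
  | refl x => rfl
  | symm _ ih => exact ih.symm
  | trans _ _ ih₁ ih₂ => exact ih₁.trans ih₂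
  | add _ _ ih₁ ih₂ => rw [map_add, map_add, ih₁, ih₂]
  | mul _ _ ih₁ ih₂ => rw [map_mul, map_mul, ih₁, ih₂]

theorem smul_p_ne_zero {A : B} {r : R} (hA : A ≠ ⊥) (hr : r ≠ 0) : r • S.p R A ≠ 0 := by
  intro h
  have hcon : S.con R (r • S.gen R (.p A)) 0 := Quotient.exact h
  have hrep := S.boundaryRep_eq_of_con R hcon
  rw [map_smul, map_zero, boundaryRep_gen] at hrep
  obtain ⟨x, hx⟩ := BPath.exists_mem_start S hA
  have := congrFun (LinearMap.congr_fun hrep fun _ => 1) x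
  simp [genOp_p_apply, hx] at this
  exact hr this

end

end Representation

end GenBoolDynSystem

/-! ### Normal forms of words, and local units for nonzero degrees. -/

namespace GenBoolDynSystem

noncomputable section

variable {B L : Type*} [GeneralizedBooleanAlgebra B] (S : GenBoolDynSystem B L)
variable (R : Type*) [CommRing R]

/-- The element `s_{α,C}` of `L_R(𝓑, ℒ, θ, 𝓘)`. -/
def s (α : L) (C : S.ideal α) : S.Alg R := S.toAlg R (S.gen R (.s α C))

/-- The element `s_{α,C}^*` of `L_R(𝓑, ℒ, θ, 𝓘)`. -/
def sStar (α : L) (C : S.ideal α) : S.Alg R := S.toAlg R (S.gen R (.sStar α C))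

theorem toAlg_eq_of_rel {a b : S.FreeAlg R} (h : S.Rel R a b) : S.toAlg R a = S.toAlg R b :=
  Quotient.sound (RingConGen.Rel.of _ _ ⟨1, a, b, h, (one_smul R a).symm, (one_smul R b).symm⟩)

theorem toAlg_mul (x y : S.FreeAlg R) : S.toAlg R (x * y) = S.toAlg R x * S.toAlg R y := rfl

theorem toAlg_smul (r : R) (x : S.FreeAlg R) : S.toAlg R (r • x) = r • S.toAlg R x := rfl

theorem toAlg_sum {ι : Type*} (F : Finset ι) (x : ι → S.FreeAlg R) :
    S.toAlg R (∑ i ∈ F, x i) = ∑ i ∈ F, S.toAlg R (x i) :=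
  map_sum (⟨⟨S.toAlg R, rfl⟩, fun _ _ => rfl⟩ : S.FreeAlg R →+ S.Alg R) x F

@[simp] theorem p_bot : S.p R ⊥ = 0 := S.toAlg_eq_of_rel R .p_bot

theorem p_mul_p (A A' : B) : S.p R A * S.p R A' = S.p R (A ⊓ A') :=
  (S.toAlg_eq_of_rel R (.p_inf A A')).symm

theorem p_sup (A A' : B) : S.p R (A ⊔ A') = S.p R A + S.p R A' - S.p R (A ⊓ A') :=
  S.toAlg_eq_of_rel R (.p_sup A A')

theorem p_mul_s (A : B) (α : L) (C : S.ideal α) :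
    S.p R A * S.s R α C = S.s R α C * S.p R (S.θ α A) :=
  S.toAlg_eq_of_rel R (.p_mul_s A α C)

theorem sStar_mul_p (A : B) (α : L) (C : S.ideal α) :
    S.sStar R α C * S.p R A = S.p R (S.θ α A) * S.sStar R α C :=
  S.toAlg_eq_of_rel R (.sStar_mul_p A α C)

theorem sStar_mul_s (α : L) (C C' : S.ideal α) :
    S.sStar R α C * S.s R α C' = S.p R ((C : B) ⊓ (C' : B)) :=
  S.toAlg_eq_of_rel R (.sStar_mul_s α C C')

theorem sStar_mul_s_of_ne {α α' : L} (C : S.ideal α) (C' : S.ideal α') (h : α ≠ α') :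
    S.sStar R α C * S.s R α' C' = 0 :=
  S.toAlg_eq_of_rel R (.sStar_mul_s_of_ne α α' C C' h)

theorem s_mul_p (α : L) (C : S.ideal α) (A : B) :
    S.s R α C * S.p R A = S.s R α (S.infI C A) :=
  S.toAlg_eq_of_rel R (.s_mul_p α C A)

theorem p_mul_sStar (α : L) (C : S.ideal α) (A : B) :
    S.p R A * S.sStar R α C = S.sStar R α (S.infI C A) :=
  S.toAlg_eq_of_rel R (.p_mul_sStar α C A)

theorem p_eq_sum {A : B} (hA : S.IsRegular A) :
    S.p R A = ∑ α ∈ hA.finite.toFinset, S.s R α (S.θI α A) * S.sStar R α (S.θI α A) := by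
  have := S.toAlg_eq_of_rel R (.p_regular A hA)
  rwa [toAlg_sum] at this

theorem s_mul_p_of_le {α : L} {C : S.ideal α} {A : B} (h : (C : B) ≤ A) :
    S.s R α C * S.p R A = S.s R α C := by
  rw [s_mul_p]
  congr 1
  exact Subtype.ext (inf_eq_left.2 h)

theorem p_mul_sStar_of_le {α : L} {C : S.ideal α} {A : B} (h : (C : B) ≤ A) :
    S.p R A * S.sStar R α C = S.sStar R α C := by
  rw [p_mul_sStar]
  congr 1
  exact Subtype.ext (inf_eq_left.2 h)

theorem p_sup_of_disjoint {A A' : B} (h : Disjoint A A') :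
    S.p R (A ⊔ A') = S.p R A + S.p R A' := by
  rw [p_sup, h.eq_bot, p_bot, sub_zero]

/-- Elements of the form `s_{α₁,C₁} ⋯ s_{αₘ,Cₘ} p_A s_{β₁,D₁}^* ⋯ s_{βₖ,Dₖ}^*`. -/
inductive IsNormal : ℕ → ℕ → S.Alg R → Prop
  | p (A : B) : IsNormal 0 0 (S.p R A)
  | s_mul {m k : ℕ} {x : S.Alg R} (α : L) (C : S.ideal α) (h : IsNormal m k x) :
      IsNormal (m + 1) k (S.s R α C * x)
  | mul_sStar {m k : ℕ} {x : S.Alg R} (α : L) (C : S.ideal α) (h : IsNormal m k x) :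
      IsNormal m (k + 1) (x * S.sStar R α C)

variable {S R}

theorem IsNormal.p_mul {m k : ℕ} {x : S.Alg R} (h : S.IsNormal R m k x) (A : B) :
    S.IsNormal R m k (S.p R A * x) := by
  induction h generalizing A with
  | p A' => rw [p_mul_p]; exact .p _
  | s_mul α C _ ih => rw [← mul_assoc, p_mul_s, mul_assoc]; exact .s_mul _ _ (ih _)
  | mul_sStar α C _ ih => rw [← mul_assoc]; exact .mul_sStar _ _ (ih _)

/-- The new factor cancels against the leading `s`, or gives zero if the letters differ; without an
`s` it passes to the right of `p_A`. The degree is recorded even for a zero product, so that words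
can be treated by induction. -/
theorem IsNormal.sStar_mul {m k : ℕ} {x : S.Alg R} (h : S.IsNormal R m k x) (α : L)
    (C : S.ideal α) : ∃ m' k' : ℕ, (m' : ℤ) - k' = m - k - 1 ∧
      (S.IsNormal R m' k' (S.sStar R α C * x) ∨ S.sStar R α C * x = 0) := by
  induction h with
  | p A =>
    refine ⟨0, 1, by simp, .inl ?_⟩
    rw [sStar_mul_p]
    exact .mul_sStar _ _ (.p _)
  | @s_mul m k x β D h _ =>
    refine ⟨m, k, by push_cast; ring, ?_⟩
    rw [← mul_assoc]
    by_cases hαβ : α = β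
    · subst hαβ
      rw [sStar_mul_s]
      exact .inl (h.p_mul _)
    · rw [sStar_mul_s_of_ne _ _ _ _ hαβ, zero_mul]
      exact .inr rfl
  | mul_sStar β D _ ih =>
    obtain ⟨m', k', hd, h⟩ := ih
    refine ⟨m', k' + 1, by push_cast; linarith, ?_⟩
    rw [← mul_assoc]
    rcases h with h | h
    · exact .inl (.mul_sStar _ _ h)
    · rw [h, zero_mul]
      exact .inr rfl

/-- The two kinds of factors may have been attached in any order, so the leftmost `s` is found
beneath the outer `s^*` by associativity. -/
theorem IsNormal.exists_s_mul {m k : ℕ} {x : S.Alg R} (h : S.IsNormal R (m + 1) k x) :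
    ∃ α C y, S.IsNormal R m k y ∧ x = S.s R α C * y := by
  generalize hm : m + 1 = m' at h
  induction h with
  | p A => cases hm
  | s_mul α C h _ =>
    cases hm
    exact ⟨α, C, _, h, rfl⟩
  | mul_sStar β D _ ih =>
    obtain ⟨α, C, y, hy, rfl⟩ := ih hm
    exact ⟨α, C, _, .mul_sStar β D hy, mul_assoc _ _ _⟩

theorem IsNormal.exists_mul_sStar {m k : ℕ} {x : S.Alg R} (h : S.IsNormal R m (k + 1) x) :
    ∃ α C y, S.IsNormal R m k y ∧ x = y * S.sStar R α C := by
  generalize hk : k + 1 = k' at h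
  induction h with
  | p A => cases hk
  | mul_sStar α C h _ =>
    cases hk
    exact ⟨α, C, _, h, rfl⟩
  | s_mul β D _ ih =>
    obtain ⟨α, C, y, hy, rfl⟩ := ih hk
    exact ⟨α, C, _, .s_mul β D hy, (mul_assoc _ _ _).symm⟩

variable (S R)

/-- The class of a word in the generating symbols. -/
def word (w : FreeSemigroup S.Gen) : S.Alg R := S.toAlg R (MonoidAlgebra.single w 1)

theorem word_of (g : S.Gen) : S.word R (.of g) = S.toAlg R (S.gen R g) := rfl

theorem word_mul (w w' : FreeSemigroup S.Gen) :
    S.word R (w * w') = S.word R w * S.word R w' := by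
  rw [word, word, word, ← toAlg_mul, MonoidAlgebra.single_mul_single, one_mul]

theorem wordDeg_of (g : S.Gen) : S.wordDeg (.of g) = g.deg := rfl

theorem wordDeg_mul (w w' : FreeSemigroup S.Gen) :
    S.wordDeg (w * w') = S.wordDeg w + S.wordDeg w' := by
  simp [wordDeg]

theorem word_isNormal (w : FreeSemigroup S.Gen) : ∃ m k : ℕ, (m : ℤ) - k = S.wordDeg w ∧
    (S.IsNormal R m k (S.word R w) ∨ S.word R w = 0) := by
  induction w using FreeSemigroup.recOnMul with
  | ih1 g =>
    rw [wordDeg_of, word_of]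
    cases g with
    | p A => exact ⟨0, 0, rfl, .inl (.p A)⟩
    | s α C =>
      refine ⟨1, 0, rfl, .inl ?_⟩
      change S.IsNormal R _ _ (S.s R α C)
      rw [← S.s_mul_p_of_le R (le_refl (C : B))]
      exact .s_mul _ _ (.p _)
    | sStar α C =>
      refine ⟨0, 1, rfl, .inl ?_⟩
      change S.IsNormal R _ _ (S.sStar R α C)
      rw [← S.p_mul_sStar_of_le R (le_refl (C : B))]
      exact .mul_sStar _ _ (.p _)
  | ih2 g w _ ih =>
    obtain ⟨m, k, hd, h⟩ := ih
    rw [wordDeg_mul, wordDeg_of, word_mul, word_of, ← hd]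
    rcases h with h | h
    · cases g with
      | p A => exact ⟨m, k, by simp [Gen.deg], .inl (h.p_mul A)⟩
      | s α C => exact ⟨m + 1, k, by simp [Gen.deg]; ring, .inl (.s_mul α C h)⟩
      | sStar α C =>
        obtain ⟨m', k', hd', h'⟩ := h.sStar_mul α C
        exact ⟨m', k', by simp only [Gen.deg]; linarith, h'⟩
    · rw [h, mul_zero]
      cases g with
      | p A => exact ⟨m, k, by simp [Gen.deg], .inr rfl⟩
      | s α C => exact ⟨m + 1, k, by simp [Gen.deg]; ring, .inr rfl⟩
      | sStar α C => exact ⟨m, k + 1, by simp [Gen.deg]; ring, .inr rfl⟩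

theorem component_eq_span (n : ℤ) :
    S.component R n = Submodule.span R {x | ∃ w, S.wordDeg w = n ∧ x = S.word R w} := rfl

theorem sStar_mul_mem_component {n : ℤ} {x : S.Alg R} (hx : x ∈ S.component R n) (α : L)
    (C : S.ideal α) : S.sStar R α C * x ∈ S.component R (n - 1) := by
  rw [component_eq_span] at hx
  induction hx using Submodule.span_induction with
  | mem x h =>
    obtain ⟨w, hw, rfl⟩ := h
    refine Submodule.subset_span ⟨FreeSemigroup.of (Gen.sStar α C) * w, ?_,
      (S.word_mul R (FreeSemigroup.of (Gen.sStar α C)) w).symm⟩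
    rw [wordDeg_mul, hw, wordDeg_of, Gen.deg]
    ring
  | zero => rw [mul_zero]; exact zero_mem _
  | add x y _ _ hx hy => rw [mul_add]; exact add_mem hx hy
  | smul r x _ hx => rw [mul_smul_comm]; exact Submodule.smul_mem _ _ hx

theorem mul_s_mem_component {n : ℤ} {x : S.Alg R} (hx : x ∈ S.component R n) (α : L)
    (C : S.ideal α) : x * S.s R α C ∈ S.component R (n + 1) := by
  rw [component_eq_span] at hx
  induction hx using Submodule.span_induction with
  | mem x h =>
    obtain ⟨w, hw, rfl⟩ := h
    refine Submodule.subset_span ⟨w * FreeSemigroup.of (.s α C), ?_, (S.word_mul R _ _).symm⟩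
    rw [wordDeg_mul, hw, wordDeg_of, Gen.deg]
  | zero => rw [zero_mul]; exact zero_mem _
  | add x y _ _ hx hy => rw [add_mul]; exact add_mem hx hy
  | smul r x _ hx => rw [smul_mul_assoc]; exact Submodule.smul_mem _ _ hx

theorem iSup_component : ⨆ n, S.component R n = ⊤ := by
  rw [eq_top_iff]
  rintro x -
  obtain ⟨a, rfl⟩ := S.toAlg_surjective R x
  induction a using MonoidAlgebra.induction_linear with
  | zero => exact zero_mem _
  | add a b ha hb => exact add_mem ha hb
  | single w r =>
    have : (MonoidAlgebra.single w r : S.FreeAlg R) = r • MonoidAlgebra.single w 1 := by simp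
    rw [this, toAlg_smul]
    exact Submodule.smul_mem _ _
      (Submodule.mem_iSup_of_mem (S.wordDeg w) (Submodule.subset_span ⟨w, rfl, rfl⟩))

/-- The span of the elements `s_{α,C} y`. -/
def leftSpan : Submodule R (S.Alg R) :=
  Submodule.span R {x | ∃ α C y, x = S.s R α C * y}

/-- The span of the elements `y s_{α,C}^*`. -/
def rightSpan : Submodule R (S.Alg R) :=
  Submodule.span R {x | ∃ α C y, x = y * S.sStar R α C}

theorem component_le_leftSpan {n : ℤ} (hn : 0 < n) : S.component R n ≤ S.leftSpan R := by
  rw [component_eq_span]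
  refine Submodule.span_le.2 ?_
  rintro _ ⟨w, hw, rfl⟩
  obtain ⟨m, k, hd, h | h⟩ := S.word_isNormal R w
  · obtain ⟨m, rfl⟩ : ∃ m', m = m' + 1 := ⟨m - 1, by omega⟩
    obtain ⟨α, C, y, -, hy⟩ := h.exists_s_mul
    exact Submodule.subset_span ⟨α, C, y, hy⟩
  · rw [h]
    exact zero_mem _

theorem component_le_rightSpan {n : ℤ} (hn : n < 0) : S.component R n ≤ S.rightSpan R := by
  rw [component_eq_span]
  refine Submodule.span_le.2 ?_
  rintro _ ⟨w, hw, rfl⟩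
  obtain ⟨m, k, hd, h | h⟩ := S.word_isNormal R w
  · obtain ⟨k, rfl⟩ : ∃ k', k = k' + 1 := ⟨k - 1, by omega⟩
    obtain ⟨α, C, y, -, hy⟩ := h.exists_mul_sStar
    exact Submodule.subset_span ⟨α, C, y, hy⟩
  · rw [h]
    exact zero_mem _

variable {S R}

theorem s_mul_sStar_mul_s (α : L) {C D : S.ideal α} (h : C ≤ D) :
    S.s R α D * (S.sStar R α D * S.s R α C) = S.s R α C := by
  rw [sStar_mul_s, s_mul_p]
  congr 1
  refine Subtype.ext ?_
  have h' : (C : B) ≤ D := h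
  simp [infI, h']

theorem sStar_mul_s_mul_sStar (α : L) {C D : S.ideal α} (h : C ≤ D) :
    S.sStar R α C * S.s R α D * S.sStar R α D = S.sStar R α C := by
  rw [sStar_mul_s, p_mul_sStar]
  congr 1
  refine Subtype.ext ?_
  have h' : (C : B) ≤ D := h
  simp [infI, h']

/-- The sums `∑ s_{α,C α} s_{α,C α}^*` act as local left units. Asking for the identity at all
larger `F'` and `C'` lets two summands share one unit. -/
theorem exists_sum_mul_eq_of_mem_leftSpan {x : S.Alg R} (hx : x ∈ S.leftSpan R) :
    ∃ (F : Finset L) (C : ∀ α, S.ideal α), ∀ (F' : Finset L) (C' : ∀ α, S.ideal α), F ⊆ F' →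
      (∀ α, C α ≤ C' α) → ∑ α ∈ F', S.s R α (C' α) * (S.sStar R α (C' α) * x) = x := by
  classical
  induction hx using Submodule.span_induction with
  | mem x h =>
    obtain ⟨α, C, y, rfl⟩ := h
    -- Only the letter `α` matters; elsewhere the least element `⊥` imposes no condition on `C'`.
    refine ⟨{α}, Function.update (fun β => ⟨⊥, (S.ideal β).bot_mem⟩) α C, fun F' C' hF hC => ?_⟩
    rw [Finset.sum_eq_single_of_mem α (hF (Finset.mem_singleton_self α))]
    · have := hC α
      rw [Function.update_self] at this
      rw [← mul_assoc (S.sStar R _ _), ← mul_assoc, s_mul_sStar_mul_s α this]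
    · intro β _ hβ
      rw [← mul_assoc (S.sStar R _ _), sStar_mul_s_of_ne _ _ _ _ hβ, zero_mul, mul_zero]
  | zero => exact ⟨∅, fun β => ⟨⊥, (S.ideal β).bot_mem⟩, by simp⟩
  | add x y _ _ hx hy =>
    obtain ⟨F, C, h⟩ := hx
    obtain ⟨F₁, C₁, h₁⟩ := hy
    refine ⟨F ∪ F₁, fun α => ⟨C α ⊔ C₁ α, Order.Ideal.sup_mem (C α).2 (C₁ α).2⟩,
      fun F' C' hF hC => ?_⟩
    simp only [mul_add, Finset.sum_add_distrib]
    rw [h F' C' (Finset.union_subset_left hF) fun α => le_trans ?_ (hC α),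
      h₁ F' C' (Finset.union_subset_right hF) fun α => le_trans ?_ (hC α)]
    · exact Subtype.coe_le_coe.1 (le_sup_right : (C₁ α : B) ≤ (C α : B) ⊔ C₁ α)
    · exact Subtype.coe_le_coe.1 (le_sup_left : (C α : B) ≤ (C α : B) ⊔ C₁ α)
  | smul r x _ hx =>
    obtain ⟨F, C, h⟩ := hx
    refine ⟨F, C, fun F' C' hF hC => ?_⟩
    simp only [mul_smul_comm, ← Finset.smul_sum, h F' C' hF hC]

theorem exists_sum_mul_eq_of_mem_rightSpan {x : S.Alg R} (hx : x ∈ S.rightSpan R) :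
    ∃ (F : Finset L) (C : ∀ α, S.ideal α), ∀ (F' : Finset L) (C' : ∀ α, S.ideal α), F ⊆ F' →
      (∀ α, C α ≤ C' α) → ∑ α ∈ F', x * S.s R α (C' α) * S.sStar R α (C' α) = x := by
  classical
  induction hx using Submodule.span_induction with
  | mem x h =>
    obtain ⟨α, C, y, rfl⟩ := h
    refine ⟨{α}, Function.update (fun β => ⟨⊥, (S.ideal β).bot_mem⟩) α C, fun F' C' hF hC => ?_⟩
    rw [Finset.sum_eq_single_of_mem α (hF (Finset.mem_singleton_self α))]
    · have := hC α
      rw [Function.update_self] at this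
      rw [mul_assoc y, mul_assoc y, sStar_mul_s_mul_sStar α this]
    · intro β _ hβ
      rw [mul_assoc y, sStar_mul_s_of_ne _ _ _ _ (Ne.symm hβ), mul_zero, zero_mul]
  | zero => exact ⟨∅, fun β => ⟨⊥, (S.ideal β).bot_mem⟩, by simp⟩
  | add x y _ _ hx hy =>
    obtain ⟨F, C, h⟩ := hx
    obtain ⟨F₁, C₁, h₁⟩ := hy
    refine ⟨F ∪ F₁, fun α => ⟨C α ⊔ C₁ α, Order.Ideal.sup_mem (C α).2 (C₁ α).2⟩,
      fun F' C' hF hC => ?_⟩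
    simp only [add_mul, Finset.sum_add_distrib]
    rw [h F' C' (Finset.union_subset_left hF) fun α => le_trans ?_ (hC α),
      h₁ F' C' (Finset.union_subset_right hF) fun α => le_trans ?_ (hC α)]
    · exact Subtype.coe_le_coe.1 (le_sup_right : (C₁ α : B) ≤ (C α : B) ⊔ C₁ α)
    · exact Subtype.coe_le_coe.1 (le_sup_left : (C α : B) ≤ (C α : B) ⊔ C₁ α)
  | smul r x _ hx =>
    obtain ⟨F, C, h⟩ := hx
    refine ⟨F, C, fun F' C' hF hC => ?_⟩
    simp only [smul_mul_assoc, ← Finset.smul_sum, h F' C' hF hC]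

theorem eq_zero_of_sStar_mul_eq_zero {x : S.Alg R} (hx : x ∈ S.leftSpan R)
    (h : ∀ α C, S.sStar R α C * x = 0) : x = 0 := by
  obtain ⟨F, C, hF⟩ := exists_sum_mul_eq_of_mem_leftSpan hx
  rw [← hF F C subset_rfl fun _ => le_rfl]
  simp [h]

theorem eq_zero_of_mul_s_eq_zero {x : S.Alg R} (hx : x ∈ S.rightSpan R)
    (h : ∀ α C, x * S.s R α C = 0) : x = 0 := by
  obtain ⟨F, C, hF⟩ := exists_sum_mul_eq_of_mem_rightSpan hx
  rw [← hF F C subset_rfl fun _ => le_rfl]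
  simp [h]

theorem exists_finset_sStar_mul_eq_zero {x : S.Alg R} (hx : x ∈ S.leftSpan R) :
    ∃ F : Finset L, ∀ α ∉ F, ∀ C, S.sStar R α C * x = 0 := by
  obtain ⟨F, C, hF⟩ := exists_sum_mul_eq_of_mem_leftSpan hx
  refine ⟨F, fun α hα D => ?_⟩
  rw [← hF F C subset_rfl fun _ => le_rfl, Finset.mul_sum]
  refine Finset.sum_eq_zero fun β hβ => ?_
  have hne : α ≠ β := fun h => hα (h ▸ hβ)
  rw [← mul_assoc, sStar_mul_s_of_ne _ _ _ _ hne, zero_mul]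

end

end GenBoolDynSystem

/-! ### The filtration of the degree-zero component. -/

namespace GenBoolDynSystem

noncomputable section

variable {B L : Type*} [GeneralizedBooleanAlgebra B] (S : GenBoolDynSystem B L)
variable (R : Type*) [CommRing R]

/-- The span of the elements `p_A`. -/
def pSpan : Submodule R (S.Alg R) := Submodule.span R (Set.range (S.p R))

/-- The span of the elements `s_{α,C} y s_{β,D}^*` with `y` in a given submodule. -/
def corner (M : Submodule R (S.Alg R)) : Submodule R (S.Alg R) :=
  Submodule.span R {x | ∃ α C, ∃ y ∈ M, ∃ β D, x = S.s R α C * y * S.sStar R β D}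

/-- The span of the normal elements with equally many, at most `n`, factors `s_{α,C}` and
`s_{β,D}^*`. -/
def level : ℕ → Submodule R (S.Alg R)
  | 0 => S.pSpan R
  | n + 1 => S.pSpan R ⊔ S.corner R (level n)

variable {S R}

theorem p_mem_pSpan (A : B) : S.p R A ∈ S.pSpan R := Submodule.subset_span ⟨A, rfl⟩

theorem pSpan_le_level (n : ℕ) : S.pSpan R ≤ S.level R n := by
  cases n with
  | zero => exact le_rfl
  | succ n => exact le_sup_left

theorem corner_mono {M N : Submodule R (S.Alg R)} (h : M ≤ N) : S.corner R M ≤ S.corner R N := by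
  refine Submodule.span_mono ?_
  rintro _ ⟨α, C, y, hy, β, D, rfl⟩
  exact ⟨α, C, y, h hy, β, D, rfl⟩

theorem level_mono : Monotone (S.level R) := by
  refine monotone_nat_of_le_succ fun n => ?_
  induction n with
  | zero => exact le_sup_left
  | succ n ih => exact sup_le_sup_left (corner_mono ih) _

theorem IsNormal.mem_level {n : ℕ} {x : S.Alg R} (h : S.IsNormal R n n x) :
    x ∈ S.level R n := by
  induction n generalizing x with
  | zero =>
    cases h with
    | p A => exact p_mem_pSpan A
  | succ n ih =>
    obtain ⟨α, C, y, hy, rfl⟩ := h.exists_s_mul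
    obtain ⟨β, D, z, hz, rfl⟩ := hy.exists_mul_sStar
    exact Submodule.mem_sup_right
      (Submodule.subset_span ⟨α, C, z, ih hz, β, D, (mul_assoc _ _ _).symm⟩)

theorem exists_mem_level {x : S.Alg R} (hx : x ∈ S.component R 0) : ∃ n, x ∈ S.level R n := by
  rw [component_eq_span] at hx
  rw [← Submodule.mem_iSup_of_directed _ level_mono.directed_le]
  refine Submodule.span_le.2 ?_ hx
  rintro _ ⟨w, hw, rfl⟩
  obtain ⟨m, k, hd, h | h⟩ := S.word_isNormal R w
  · obtain rfl : m = k := by omega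
    exact Submodule.mem_iSup_of_mem m h.mem_level
  · rw [h]
    exact zero_mem _

theorem p_mul_mem_pSpan {x : S.Alg R} (hx : x ∈ S.pSpan R) (A : B) :
    S.p R A * x ∈ S.pSpan R := by
  induction hx using Submodule.span_induction with
  | mem x h =>
    obtain ⟨C, rfl⟩ := h
    rw [p_mul_p]
    exact p_mem_pSpan _
  | zero => rw [mul_zero]; exact zero_mem _
  | add x y _ _ hx hy => rw [mul_add]; exact add_mem hx hy
  | smul r x _ hx => rw [mul_smul_comm]; exact Submodule.smul_mem _ _ hx

theorem mul_p_mem_pSpan {x : S.Alg R} (hx : x ∈ S.pSpan R) (A : B) :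
    x * S.p R A ∈ S.pSpan R := by
  induction hx using Submodule.span_induction with
  | mem x h =>
    obtain ⟨C, rfl⟩ := h
    rw [p_mul_p]
    exact p_mem_pSpan _
  | zero => rw [zero_mul]; exact zero_mem _
  | add x y _ _ hx hy => rw [add_mul]; exact add_mem hx hy
  | smul r x _ hx => rw [smul_mul_assoc]; exact Submodule.smul_mem _ _ hx

theorem p_mul_mem_corner {M : Submodule R (S.Alg R)} {x : S.Alg R} (hx : x ∈ S.corner R M)
    (A : B) : S.p R A * x ∈ S.corner R M := by
  induction hx using Submodule.span_induction with
  | mem x h =>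
    obtain ⟨α, C, y, hy, β, D, rfl⟩ := h
    rw [← mul_assoc, ← mul_assoc, p_mul_s, s_mul_p]
    exact Submodule.subset_span ⟨α, _, y, hy, β, D, rfl⟩
  | zero => rw [mul_zero]; exact zero_mem _
  | add x y _ _ hx hy => rw [mul_add]; exact add_mem hx hy
  | smul r x _ hx => rw [mul_smul_comm]; exact Submodule.smul_mem _ _ hx

theorem mul_p_mem_corner {M : Submodule R (S.Alg R)} {x : S.Alg R} (hx : x ∈ S.corner R M)
    (A : B) : x * S.p R A ∈ S.corner R M := by
  induction hx using Submodule.span_induction with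
  | mem x h =>
    obtain ⟨α, C, y, hy, β, D, rfl⟩ := h
    rw [mul_assoc, sStar_mul_p, p_mul_sStar]
    exact Submodule.subset_span ⟨α, _, y, hy, β, _, rfl⟩
  | zero => rw [zero_mul]; exact zero_mem _
  | add x y _ _ hx hy => rw [add_mul]; exact add_mem hx hy
  | smul r x _ hx => rw [smul_mul_assoc]; exact Submodule.smul_mem _ _ hx

theorem p_mul_mem_level {n : ℕ} {x : S.Alg R} (hx : x ∈ S.level R n) (A : B) :
    S.p R A * x ∈ S.level R n := by
  cases n with
  | zero => exact p_mul_mem_pSpan hx A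
  | succ n =>
    obtain ⟨y, hy, z, hz, rfl⟩ := Submodule.mem_sup.1 hx
    rw [mul_add]
    exact Submodule.add_mem_sup (p_mul_mem_pSpan hy A) (p_mul_mem_corner hz A)

theorem mul_p_mem_level {n : ℕ} {x : S.Alg R} (hx : x ∈ S.level R n) (A : B) :
    x * S.p R A ∈ S.level R n := by
  cases n with
  | zero => exact mul_p_mem_pSpan hx A
  | succ n =>
    obtain ⟨y, hy, z, hz, rfl⟩ := Submodule.mem_sup.1 hx
    rw [add_mul]
    exact Submodule.add_mem_sup (mul_p_mem_pSpan hy A) (mul_p_mem_corner hz A)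

/-- Compression by `s^*` and `s` strips the outer factors of a corner; this drives the induction on
the level. -/
theorem sStar_mul_mul_s_mem {n : ℕ} {x : S.Alg R} (hx : x ∈ S.corner R (S.level R n)) (α : L)
    (C : S.ideal α) (β : L) (D : S.ideal β) :
    S.sStar R α C * x * S.s R β D ∈ S.level R n := by
  induction hx using Submodule.span_induction with
  | mem x h =>
    obtain ⟨α', C', y, hy, β', D', rfl⟩ := h
    have key : S.sStar R α C * (S.s R α' C' * y * S.sStar R β' D') * S.s R β D =
        (S.sStar R α C * S.s R α' C') * y * (S.sStar R β' D' * S.s R β D) := by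
      simp only [mul_assoc]
    rw [key]
    by_cases hα : α = α'
    · by_cases hβ : β' = β
      · subst hα hβ
        rw [sStar_mul_s, sStar_mul_s]
        exact mul_p_mem_level (p_mul_mem_level hy _) _
      · rw [sStar_mul_s_of_ne _ _ _ _ hβ, mul_zero]
        exact zero_mem _
    · rw [sStar_mul_s_of_ne _ _ _ _ hα, zero_mul, zero_mul]
      exact zero_mem _
  | zero => rw [mul_zero, zero_mul]; exact zero_mem _
  | add x y _ _ hx hy => rw [mul_add, add_mul]; exact add_mem hx hy
  | smul r x _ hx => rw [mul_smul_comm, smul_mul_assoc]; exact Submodule.smul_mem _ _ hx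

theorem corner_le_leftSpan (M : Submodule R (S.Alg R)) : S.corner R M ≤ S.leftSpan R := by
  refine Submodule.span_mono ?_
  rintro _ ⟨α, C, y, -, β, D, rfl⟩
  exact ⟨α, C, _, mul_assoc _ _ _⟩

theorem corner_le_rightSpan (M : Submodule R (S.Alg R)) : S.corner R M ≤ S.rightSpan R := by
  refine Submodule.span_mono ?_
  rintro _ ⟨α, C, y, -, β, D, rfl⟩
  exact ⟨β, D, _, rfl⟩

/-- For the converse implication, relation 5 enters only here. A factor `p_{θ_α(A)}` is inserted in
the middle of each of its summands. -/
theorem p_mem_corner_of_isRegular {A : B} (hA : S.IsRegular A) (n : ℕ) :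
    S.p R A ∈ S.corner R (S.level R n) := by
  rw [S.p_eq_sum R hA]
  refine sum_mem fun α _ => Submodule.subset_span
    ⟨α, S.θI α A, S.p R (S.θ α A), pSpan_le_level n (p_mem_pSpan _), α, S.θI α A, ?_⟩
  rw [s_mul_p_of_le]
  exact le_rfl

theorem exists_p_mul_eq {x : S.Alg R} (hx : x ∈ S.pSpan R) : ∃ A, S.p R A * x = x := by
  -- The stronger form, for every larger `A'`, passes to sums by taking joins.
  have : ∃ A, ∀ A', A ≤ A' → S.p R A' * x = x := by
    induction hx using Submodule.span_induction with
    | mem x h =>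
      obtain ⟨C, rfl⟩ := h
      exact ⟨C, fun A' h => by rw [p_mul_p, inf_eq_right.2 h]⟩
    | zero => exact ⟨⊥, by simp⟩
    | add x y _ _ hx hy =>
      obtain ⟨A, hA⟩ := hx
      obtain ⟨A₁, hA₁⟩ := hy
      exact ⟨A ⊔ A₁, fun A' h => by
        rw [mul_add, hA A' (le_sup_left.trans h), hA₁ A' (le_sup_right.trans h)]⟩
    | smul r x _ hx =>
      obtain ⟨A, hA⟩ := hx
      exact ⟨A, fun A' h => by rw [mul_smul_comm, hA A' h]⟩
  obtain ⟨A, hA⟩ := this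
  exact ⟨A, hA A le_rfl⟩

theorem p_mul_eq_smul_of_le {x : S.Alg R} {A A' : B} {r : R} (h : S.p R A * x = r • S.p R A)
    (hle : A' ≤ A) : S.p R A' * x = r • S.p R A' := by
  have hp : S.p R A' * S.p R A = S.p R A' := by rw [p_mul_p, inf_eq_left.2 hle]
  rw [← hp, mul_assoc, h, mul_smul_comm]

/-- Below every element, an element of the span of the `p_A` is piecewise constant. -/
theorem induction_of_mem_pSpan {x : S.Alg R} (hx : x ∈ S.pSpan R) {Φ : B → Prop}
    (hΦ : ∀ A A', Disjoint A A' → Φ A → Φ A' → Φ (A ⊔ A')) {A : B}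
    (h : ∀ C ≤ A, ∀ r : R, S.p R C * x = r • S.p R C → Φ C) : Φ A := by
  induction hx using Submodule.span_induction generalizing A with
  | mem x hx =>
    obtain ⟨D, rfl⟩ := hx
    rw [← sup_inf_sdiff A D]
    refine hΦ _ _ disjoint_inf_sdiff (h _ inf_le_left 1 ?_) (h _ sdiff_le 0 ?_)
    · rw [p_mul_p, one_smul, inf_assoc, inf_idem]
    · rw [p_mul_p, zero_smul, inf_comm, inf_sdiff_self_right, p_bot]
  | zero => exact h A le_rfl 0 (by simp)
  | add x y _ _ ihx ihy =>
    -- Each piece on which `x` is constant is cut further into pieces on which `y` is constant.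
    refine ihx fun C hC r hr => ihy fun C' hC' r' hr' => h C' (hC'.trans hC) (r + r') ?_
    rw [mul_add, p_mul_eq_smul_of_le hr hC', hr', add_smul]
  | smul t x _ ih =>
    refine ih fun C hC r hr => h C hC (t * r) ?_
    rw [mul_smul_comm, hr, mul_smul]

/-- Some `p_A` fixes `x`, and `A` splits into disjoint pieces on which `x` is constant, so `x` is a
sum of the elements tested in `h`. -/
theorem mem_of_mem_pSpan {x : S.Alg R} (hx : x ∈ S.pSpan R) (M : Submodule R (S.Alg R))
    (h : ∀ (C : B) (r : R), S.p R C * x = r • S.p R C → r • S.p R C ∈ M) : x ∈ M := by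
  obtain ⟨A, hA⟩ := exists_p_mul_eq hx
  rw [← hA]
  refine induction_of_mem_pSpan hx (Φ := fun A => S.p R A * x ∈ M) ?_ ?_
  · intro A A' hd h h'
    rw [p_sup_of_disjoint _ _ hd, add_mul]
    exact add_mem h h'
  · intro C _ r hr
    rw [hr]
    exact h C r hr

theorem p_mul_eq_zero_of_mem_leftSpan {x : S.Alg R} (hx : x ∈ S.leftSpan R) {A : B}
    (hA : S.Δ A = ∅) : S.p R A * x = 0 := by
  induction hx using Submodule.span_induction with
  | mem x h =>
    obtain ⟨α, C, y, rfl⟩ := h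
    have : S.θ α A = ⊥ := by
      by_contra h
      exact (Set.eq_empty_iff_forall_notMem.1 hA α) h
    rw [← mul_assoc, p_mul_s, this, p_bot, mul_zero, zero_mul]
  | zero => rw [mul_zero]
  | add x y _ _ hx hy => rw [mul_add, hx, hy, add_zero]
  | smul r x _ hx => rw [mul_smul_comm, hx, smul_zero]

/-! ### Triviality of the kernel, degree by degree. -/

section Uniqueness

variable {T : Type*} [NonUnitalRing T] [Module R T] {f : S.Alg R →ₙₐ[R] T}

theorem eq_zero_of_mem_pSpan (hp : ∀ (A : B) (r : R), A ≠ ⊥ → r ≠ 0 → f (r • S.p R A) ≠ 0)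
    {x : S.Alg R} (hx : x ∈ S.pSpan R) (hfx : f x = 0) : x = 0 := by
  rw [← Submodule.mem_bot R]
  refine mem_of_mem_pSpan hx ⊥ fun C r hr => ?_
  rw [Submodule.mem_bot]
  by_contra h0
  refine hp C r ?_ ?_ ?_
  · rintro rfl
    simp at h0
  · rintro rfl
    simp at h0
  · rw [← hr, map_mul, hfx, mul_zero]

/-- Let `C ≤ A` be nonempty. If `Δ_C` is empty, `p_C` annihilates `z`, so `f` kills `r • p_C`. If
`Δ_C` is infinite, some `α ∈ Δ_C` does not occur in `z`; compressing `q + z` by `s_{α,θ_α(C)}`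
leaves `r • p_{θ_α(C)}`, which `f` kills. Both contradict `hp`. -/
theorem isRegular_of_map_eq_zero
    (hp : ∀ (A : B) (r : R), A ≠ ⊥ → r ≠ 0 → f (r • S.p R A) ≠ 0)
    {q z : S.Alg R} (hz : z ∈ S.leftSpan R) (hf : f (q + z) = 0)
    {A : B} {r : R} (hr : S.p R A * q = r • S.p R A) (hr0 : r ≠ 0) : S.IsRegular A := by
  intro C hCA hC
  have hrC := p_mul_eq_smul_of_le hr hCA
  constructor
  · by_contra hΔ
    refine hp C r hC hr0 ?_
    have : r • S.p R C = S.p R C * (q + z) := by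
      rw [mul_add, p_mul_eq_zero_of_mem_leftSpan hz (Set.not_nonempty_iff_eq_empty.1 hΔ), hrC,
        add_zero]
    rw [this, map_mul, hf, mul_zero]
  · by_contra hΔ
    obtain ⟨F, hF⟩ := exists_finset_sStar_mul_eq_zero hz
    obtain ⟨α, hα, hαF⟩ := Set.Infinite.exists_notMem_finset hΔ F
    refine hp (S.θ α C) r hα hr0 ?_
    have hsp : S.sStar R α (S.θI α C) * S.p R C = S.sStar R α (S.θI α C) := by
      rw [sStar_mul_p, p_mul_sStar_of_le]
      exact le_rfl
    have : r • S.p R (S.θ α C) =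
        S.sStar R α (S.θI α C) * (q + z) * S.s R α (S.θI α C) := by
      rw [mul_add, hF α hαF, add_zero, ← hsp, mul_assoc (S.sStar R _ _), hrC, mul_smul_comm,
        hsp, smul_mul_assoc, sStar_mul_s, inf_idem]
      rfl
    rw [this, map_mul, map_mul, hf, mul_zero, zero_mul]

theorem eq_zero_of_mem_level (hp : ∀ (A : B) (r : R), A ≠ ⊥ → r ≠ 0 → f (r • S.p R A) ≠ 0)
    {n : ℕ} {x : S.Alg R} (hx : x ∈ S.level R n) (hfx : f x = 0) : x = 0 := by
  induction n generalizing x with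
  | zero => exact eq_zero_of_mem_pSpan hp hx hfx
  | succ n ih =>
    -- The part `q` is absorbed into the corner: its nonzero pieces sit on regular elements.
    have hx' : x ∈ S.corner R (S.level R n) := by
      obtain ⟨q, hq, z, hz, rfl⟩ := Submodule.mem_sup.1 hx
      refine add_mem (mem_of_mem_pSpan hq _ fun C r hr => ?_) hz
      by_cases hr0 : r = 0
      · rw [hr0, zero_smul]
        exact zero_mem _
      · exact Submodule.smul_mem _ _ (p_mem_corner_of_isRegular
          (isRegular_of_map_eq_zero hp (corner_le_leftSpan _ hz) hfx hr hr0) n)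
    have hss : ∀ α C β D, S.sStar R α C * x * S.s R β D = 0 := fun α C β D =>
      ih (sStar_mul_mul_s_mem hx' α C β D) (by rw [map_mul, map_mul, hfx, mul_zero, zero_mul])
    refine eq_zero_of_mul_s_eq_zero (corner_le_rightSpan _ hx') fun β D => ?_
    obtain ⟨F, C, hF⟩ := exists_sum_mul_eq_of_mem_leftSpan (corner_le_leftSpan _ hx')
    rw [← hF F C subset_rfl fun _ => le_rfl, Finset.sum_mul]
    refine Finset.sum_eq_zero fun α _ => ?_
    rw [mul_assoc, hss, mul_zero]

theorem eq_zero_of_mem_component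
    (hp : ∀ (A : B) (r : R), A ≠ ⊥ → r ≠ 0 → f (r • S.p R A) ≠ 0)
    {n : ℤ} {x : S.Alg R} (hx : x ∈ S.component R n) (hfx : f x = 0) : x = 0 := by
  induction n using Int.induction_on generalizing x with
  | zero =>
    obtain ⟨n, hn⟩ := exists_mem_level hx
    exact eq_zero_of_mem_level hp hn hfx
  | succ n ih =>
    refine eq_zero_of_sStar_mul_eq_zero (S.component_le_leftSpan R (by omega) hx)
      fun α C => ih ?_ ?_
    · simpa using S.sStar_mul_mem_component R hx α C
    · rw [map_mul, hfx, mul_zero]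
  | pred n ih =>
    refine eq_zero_of_mul_s_eq_zero (S.component_le_rightSpan R (by omega) hx)
      fun α C => ih ?_ ?_
    · simpa using S.mul_s_mem_component R hx α C
    · rw [map_mul, hfx, zero_mul]

theorem injective_of_map_smul_p_ne_zero {𝒯 : ℤ → Submodule R T} (h𝒯 : iSupIndep 𝒯)
    (hf : ∀ (n : ℤ) (x : S.Alg R), x ∈ S.component R n → f x ∈ 𝒯 n)
    (hp : ∀ (A : B) (r : R), A ≠ ⊥ → r ≠ 0 → f (r • S.p R A) ≠ 0) : Function.Injective f := by
  classical
  rw [injective_iff_map_eq_zero]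
  intro x hfx
  -- Only spanning by the components is needed here, not that their sum is direct; independence is
  -- used in `T`.
  obtain ⟨y, rfl⟩ := (Submodule.mem_iSup_iff_exists_dfinsupp' (S.component R) x).1
    (by rw [iSup_component]; trivial)
  rw [DFinsupp.sum, map_sum] at hfx
  have hy := (iSupIndep_iff_finsetSum_eq_zero_imp_eq_zero 𝒯).1 h𝒯 y.support (fun n => f (y n))
    (fun n _ => hf n _ (y n).2) hfx
  exact Finset.sum_eq_zero fun n hn => eq_zero_of_mem_component hp (y n).2 (hy n hn)

end Uniqueness

end

end GenBoolDynSystem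

theorem mainTheorem1 {R : Type*} [CommRing R] {B L : Type*} [GeneralizedBooleanAlgebra B]
    (S : GenBoolDynSystem B L)
    {T : Type*} [NonUnitalRing T] [Module R T] [IsScalarTower R T T] [SMulCommClass R T T]
    (𝒯 : ℤ → Submodule R T) (h𝒯 : DirectSum.IsInternal 𝒯) (h𝒯_mul : SetLike.GradedMul 𝒯)
    (f : S.Alg R →ₙₐ[R] T) (hf : ∀ (n : ℤ) (x : S.Alg R), x ∈ S.component R n → f x ∈ 𝒯 n) :
    Function.Injective f ↔ ∀ (A : B) (r : R), A ≠ ⊥ → r ≠ 0 → f (r • S.p R A) ≠ 0 := by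
  refine ⟨fun hinj A r hA hr h0 => S.smul_p_ne_zero R hA hr (hinj (by rw [h0, map_zero])),
    GenBoolDynSystem.injective_of_map_smul_p_ne_zero h𝒯.submodule_iSupIndep hf⟩
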